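/- **Theorem.** Let $N,L\ge 0$ and $M\ge 1$ be integers. Let $\mathbf H=(h_{ij})$ be a random $N\times M$ matrix with independent log-normal entries, $\ln h_{ij}\sim\mathcal N(\mu_{ij},\sigma_{ij}^2)$ with $\sigma_{ij}>0$, and let $\mathbf h_1,\dots,\mathbf h_M$ be its columns. Let $\mathcal X\subseteq\mathbb R_+^{L\times N}$ be a set of matrices with nonnegative entries. For distinct $\mathbf X,\hat{\mathbf X}\in\mathcal X$ put $\Delta\mathbf X=\mathbf X-\hat{\mathbf X}$, and for SNR $\rho>0$ define the average pairwise error probability of the maximum-likelihood receiver by $$P(\mathbf X\to\hat{\mathbf X})=\mathbb E_{\mathbf H}\Big[Q\big(\tfrac{d}{2}\big)\Big],\qquad d^2=\frac{\rho}{N}\sum_{j=1}^{M}\mathbf h_j^T\Delta\mathbf X^T\Delta\mathbf X\,\mathbf h_j,$$ where $Q(x)$ is the probability that a standard normal variable exceeds $x$. Distinct indices $n_1,\dots,n_r\in\{1,\dots,N\}$ form a *cover link* of a positive semidefinite matrix $\mathbf G\in\mathbb R^{N\times N}$ if there are constants $\bar c_{1},\dots,\bar c_{r}$ such that for every $\tau>0$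 $$\{\mathbf h\in\mathbb R_+^N:\mathbf h^T\mathbf G\mathbf h\le\tau^2\}\subseteq\{\mathbf h:0\le h_{n_k}\le \bar c_{k}\tau,\ k=1,\dots,r\}.$$ The *cover order* $R_c(\mathbf G)$ is the largest length $r\ge 0$ of a cover link, and $\mathbf G$ has *full cover* if $R_c(\mathbf G)=N$. Then for all $\mathbf X\ne\hat{\mathbf X}$ in $\mathcal X$, with $R_c=R_c(\Delta\mathbf X^T\Delta\mathbf X)$, the limit $$\mathcal D_l(\Delta\mathbf X)=-\lim_{\rho\to\infty}\frac{8\ln P(\mathbf X\to\hat{\mathbf X})}{\ln^2\rho}$$ exists and is finite, and: 1. for every $r$ and every cover link $n_1,\dots,n_r$ of $\Delta\mathbf X^T\Delta\mathbf X$, one has $\mathcal D_l(\Delta\mathbf X)=\sum_{j=1}^M\sum_{k=1}^{r}\sigma_{n_k j}^{-2}$ if and only if $R_c=r$; 2. for every enumeration $i_1,\dots,i_N$ of $\{1,\dots,N\}$ such that $i_1,\dots,i_{R_c}$ is a cover link of $\Delta\mathbf X^T\Delta\mathbf X$, and every $r\in\{0,\dots,N\}$, one has $\mathcal D_l(\Delta\mathbf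 X)=\sum_{j=1}^M\sum_{k=1}^{r}\sigma_{i_k j}^{-2}$ if and only if $R_c=r$; 3. $\mathcal D_l(\Delta\mathbf X)=\sum_{j=1}^M\sum_{i=1}^{N}\sigma_{ij}^{-2}$ if and only if $\Delta\mathbf X^T\Delta\mathbf X$ has full cover. Consequently $\mathcal X$ achieves full large-scale diversity (that is, $\mathcal D_l(\Delta\mathbf X)=\sum_{j=1}^M\sum_{i=1}^{N}\sigma_{ij}^{-2}$ for all $\mathbf X\ne\hat{\mathbf X}$ in $\mathcal X$) if and only if $\Delta\mathbf X^T\Delta\mathbf X$ has full cover for all $\mathbf X\ne\hat{\mathbf X}$ in $\mathcal X$. -/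

import Mathlib

open MeasureTheory ProbabilityTheory Filter Topology Matrix

noncomputable section

namespace OpticalMIMO

variable {N M L : ℕ}

/-- The distinct indices `n 0, …, n (r - 1)` form a cover link of the quadratic form `hᵀ G h`:
there are constants `c k`, independent of `τ`, such that for every `τ > 0` the part
`{h ≥ 0 : hᵀ G h ≤ τ ^ 2}` of the nonnegative orthant is contained in
`{h : 0 ≤ h (n k) ≤ c k * τ for all k}`. -/
def IsCoverLink (G : Matrix (Fin N) (Fin N) ℝ) {r : ℕ} (n : Fin r → Fin N) : Prop :=
  Function.Injective n ∧
    ∃ c : Fin r → ℝ, ∀ τ : ℝ, 0 < τ →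
      {h : Fin N → ℝ | (∀ i, 0 ≤ h i) ∧ h ⬝ᵥ (G *ᵥ h) ≤ τ ^ 2} ⊆
        {h : Fin N → ℝ | ∀ k, 0 ≤ h (n k) ∧ h (n k) ≤ c k * τ}

/-- `G` is `r`-covered by a super-rectangle. -/
def IsCovered (G : Matrix (Fin N) (Fin N) ℝ) (r : ℕ) : Prop :=
  ∃ n : Fin r → Fin N, IsCoverLink G n

/-- The cover order `R_c`: the largest `r` such that `G` is `r`-covered. -/
def coverOrder (G : Matrix (Fin N) (Fin N) ℝ) : ℕ :=
  sSup {r : ℕ | IsCovered G r}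

/-- Full cover: the cover order is the number `N` of transmitter apertures. -/
def HasFullCover (G : Matrix (Fin N) (Fin N) ℝ) : Prop :=
  coverOrder G = N

theorem IsCovered.le {G : Matrix (Fin N) (Fin N) ℝ} {r : ℕ} (h : IsCovered G r) : r ≤ N := by
  obtain ⟨n, hn, -⟩ := h
  simpa using Fintype.card_le_of_injective n hn

theorem isCovered_zero (G : Matrix (Fin N) (Fin N) ℝ) : IsCovered G 0 :=
  ⟨Fin.elim0, fun a => a.elim0, Fin.elim0, fun _ _ _ _ k => k.elim0⟩

/-- The supremum defining the cover order is a maximum. -/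
theorem isCovered_coverOrder (G : Matrix (Fin N) (Fin N) ℝ) : IsCovered G (coverOrder G) :=
  Nat.sSup_mem ⟨0, isCovered_zero G⟩ ⟨N, fun _ h => IsCovered.le h⟩

theorem coverOrder_le (G : Matrix (Fin N) (Fin N) ℝ) : coverOrder G ≤ N :=
  (isCovered_coverOrder G).le

/-- The error coding matrix `ΔXᵀ ΔX` with `ΔX = X - X'`. -/
def errorGram (X X' : Matrix (Fin L) (Fin N) ℝ) : Matrix (Fin N) (Fin N) ℝ :=
  (X - X')ᵀ * (X - X')

/-- The log-normal distribution: the law of `exp z` for `z` normal with mean `m` and standard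
deviation `s`. -/
def logNormal (m s : ℝ) : Measure ℝ :=
  (gaussianReal m (Real.toNNReal (s ^ 2))).map Real.exp

/-- The entries of the random channel matrix `H` are independent, and the `(i, j)` entry is
log-normal with parameters `μ i j` and `σ i j`. -/
structure IsLogNormalFading {Ω : Type*} [MeasurableSpace Ω] (P : Measure Ω)
    (H : Ω → Matrix (Fin N) (Fin M) ℝ) (μ σ : Fin N → Fin M → ℝ) : Prop where
  indep : iIndepFun (fun (p : Fin N × Fin M) (ω : Ω) => H ω p.1 p.2) P
  law : ∀ i j, HasLaw (fun ω => H ω i j) (logNormal (μ i j) (σ i j)) P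

/-- The Gaussian tail function `Q`. -/
def gaussianQ (x : ℝ) : ℝ :=
  (gaussianReal 0 1).real (Set.Ioi x)

/-- The squared distance `d ^ 2 = (ρ / N) ∑ⱼ hⱼᵀ ΔXᵀ ΔX hⱼ`, where `hⱼ` is the `j`-th column of
the channel matrix. -/
def sqDist (ρ : ℝ) (X X' : Matrix (Fin L) (Fin N) ℝ) (H : Matrix (Fin N) (Fin M) ℝ) : ℝ :=
  ρ / N * ∑ j, (fun i => H i j) ⬝ᵥ (errorGram X X' *ᵥ fun i => H i j)

/-- The conditional pairwise error probability of the maximum-likelihood receiver, given the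
channel matrix: `Q (d / 2)`. -/
def condPairwiseError (ρ : ℝ) (X X' : Matrix (Fin L) (Fin N) ℝ)
    (H : Matrix (Fin N) (Fin M) ℝ) : ℝ :=
  gaussianQ (Real.sqrt (sqDist ρ X X' H) / 2)

/-- The average pairwise error probability over the random channel. -/
def pairwiseError {Ω : Type*} [MeasurableSpace Ω] (P : Measure Ω)
    (H : Ω → Matrix (Fin N) (Fin M) ℝ) (ρ : ℝ) (X X' : Matrix (Fin L) (Fin N) ℝ) : ℝ :=
  ∫ ω, condPairwiseError ρ X X' (H ω) ∂P

/-- The limit defining the large-scale diversity gain exists and equals `D`. -/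
def HasLargeScaleDiversityGain {Ω : Type*} [MeasurableSpace Ω] (P : Measure Ω)
    (H : Ω → Matrix (Fin N) (Fin M) ℝ) (X X' : Matrix (Fin L) (Fin N) ℝ) (D : ℝ) : Prop :=
  Tendsto (fun ρ : ℝ => -(8 * Real.log (pairwiseError P H ρ X X') / Real.log ρ ^ 2)) atTop (𝓝 D)

/-- Full large-scale diversity of a constellation: every pair of distinct codewords has
large-scale diversity gain equal to the sum of all `σ i j ^ (-2)`. -/
def AchievesFullLargeScaleDiversity {Ω : Type*} [MeasurableSpace Ω] (P : Measure Ω)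
    (H : Ω → Matrix (Fin N) (Fin M) ℝ) (σ : Fin N → Fin M → ℝ)
    (C : Set (Matrix (Fin L) (Fin N) ℝ)) : Prop :=
  ∀ X ∈ C, ∀ X' ∈ C, X ≠ X' →
    HasLargeScaleDiversityGain P H X X' (∑ j, ∑ i, (σ i j ^ 2)⁻¹)

end OpticalMIMO

end

/-!
Call an index `i` covered if on the nonnegative orthant `hᵀ G h ≤ τ ^ 2` bounds `h i` by a multiple
of `τ`, where `G = ΔXᵀ ΔX`. A cover link is the same as an injective tuple of covered indices
(`isCoverLink_iff`), so the cover order is the number of covered indices (`coverOrder_eq_card`).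
It therefore suffices to show that the diversity gain is the sum of `σ i j ^ (-2)` over all `j` and
all covered `i` (`IsLogNormalFading.hasLargeScaleDiversityGain`): these terms are positive, so
two such sums over nested index sets agree only if the sets have the same size.

The geometric input is that some nonnegative `v` with `ΔX v = 0` is positive exactly at the indices
that are not covered (`exists_ker_pos_iff_notMem_coveredIndices`). It rests on an error bound of
Hoffman type for linear maps on the orthant (`exists_coord_le_of_ker`).

* For the upper bound on the error probability, take `τ` of order `ρ ^ (-1/2) ln ρ`. Either the
  squared distance is at least `ρ τ ^ 2 / N`, of order `ln² ρ`, in which case the conditional error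
  probability is negligible, or `h i j ≤ c τ` for all covered `i` and all `j`
  (`IsLogNormalFading.pairwiseError_le`).
* For the lower bound, suppose that `h i j - v i` lies in `(0, ρ ^ (-1/2)]` for all `i` and `j`.
  Then the squared distance is bounded independently of `ρ`, and so the conditional error
  probability is bounded below (`IsLogNormalFading.exists_le_pairwiseError`).

By independence both events have product probabilities. As `ln τ ∼ -(ln ρ) / 2`, a factor
`P(h i j ≤ c τ)` is a Gaussian tail at distance about `ln ρ / 2` from the mean and decays like
`exp (-ln² ρ / (8 σ i j ^ 2))` (`tendsto_logRate_logNormal_Ioc_zero`). A factor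
`P(v i < h i j ≤ v i + ρ ^ (-1/2))` with `v i > 0` decays only like a power of `ρ`, which is
invisible at the scale of `ln² ρ` (`tendsto_logRate_logNormal_Ioc_pos`). So both bounds have the
same rate.
-/

noncomputable section

namespace OpticalMIMO

variable {N M L : ℕ}

/-! ### Linear maps on the nonnegative orthant -/

/-- If the kernel of `f` contains no nonnegative vector with a positive `i`-th coordinate, then
on the nonnegative orthant the `i`-th coordinate is bounded by a multiple of `‖f h‖`. The
constant is found by induction on a set `T` supporting `h`: either `f` is injective on the vectors
supported in `T`, or `h` can be moved along the kernel, without decreasing `h i`, until one more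
coordinate vanishes. -/
theorem exists_coord_le_of_ker {ι E : Type*} [Fintype ι] [DecidableEq ι]
    [NormedAddCommGroup E] [NormedSpace ℝ E] (f : (ι → ℝ) →ₗ[ℝ] E) (i : ι)
    (hf : ∀ v : ι → ℝ, (∀ k, 0 ≤ v k) → f v = 0 → v i = 0) (T : Finset ι) :
    ∃ c : ℝ, 0 ≤ c ∧ ∀ h : ι → ℝ, (∀ k, 0 ≤ h k) → (∀ k, k ∉ T → h k = 0) →
      h i ≤ c * ‖f h‖ := by
  induction T using Finset.strongInduction with
  | H T ih =>
  let W : Submodule ℝ (ι → ℝ) :=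
    { carrier := {h | ∀ k, k ∉ T → h k = 0}
      zero_mem' := fun _ _ => rfl
      add_mem' := fun {a b} ha hb k hk => by simp [ha k hk, hb k hk]
      smul_mem' := fun c a ha k hk => by simp [ha k hk] }
  by_cases hker : (f.domRestrict W).ker = ⊥
  · obtain ⟨K, -, hK⟩ := LinearMap.exists_antilipschitzWith _ hker
    refine ⟨K, K.2, fun h _ hT => ?_⟩
    have h1 := hK.le_mul_dist ⟨h, hT⟩ 0
    rw [map_zero, dist_zero_right, dist_zero_right] at h1
    exact (le_abs_self _).trans ((norm_le_pi_norm h i).trans h1)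
  · -- a kernel vector with a negative coordinate that does not decrease the `i`-th coordinate
    obtain ⟨u, huT, hfu, hui, k₁, hk₁⟩ : ∃ u : ι → ℝ, (∀ k, k ∉ T → u k = 0) ∧ f u = 0 ∧
        0 ≤ u i ∧ ∃ k, u k < 0 := by
      obtain ⟨u, hu, hu0⟩ := (Submodule.ne_bot_iff _).1 hker
      have hfu : f u.1 = 0 := hu
      have key : ∀ w : ι → ℝ, f w = 0 → 0 < w i → ∃ k, w k < 0 := by
        intro w hw hwi
        by_contra! hneg
        exact hwi.ne' (hf w hneg hw)
      rcases lt_trichotomy (u.1 i) 0 with hi | hi | hi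
      · refine ⟨-u.1, fun k hk => by simp [u.2 k hk], by simp [hfu], by simp [hi.le], ?_⟩
        exact key _ (by simp [hfu]) (by simpa using hi)
      · by_cases hneg : ∃ k, u.1 k < 0
        · exact ⟨u.1, u.2, hfu, hi.ge, hneg⟩
        · push Not at hneg
          obtain ⟨k, hk⟩ : ∃ k, u.1 k ≠ 0 := by
            by_contra! h0
            exact hu0 (Subtype.ext (funext h0))
          exact ⟨-u.1, fun k hk => by simp [u.2 k hk], by simp [hfu], by simp [hi], k, by
            simpa using lt_of_le_of_ne (hneg k) hk.symm⟩
      · exact ⟨u.1, u.2, hfu, hi.le, key _ hfu hi⟩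
    have hmem : ∀ k, u k < 0 → k ∈ T := fun k hk => by
      by_contra hkT
      exact hk.ne (huT k hkT)
    choose! c hc0 hc using fun k (hk : k ∈ T) => ih (T.erase k) (Finset.erase_ssubset hk)
    refine ⟨∑ k ∈ T, c k, Finset.sum_nonneg hc0, fun h hh hT => ?_⟩
    -- the first coordinate to vanish along the ray `h + t u`
    obtain ⟨k₀, hk₀, hmin⟩ := Finset.exists_min_image (T.filter fun k => u k < 0)
      (fun k => h k / (-u k)) ⟨k₁, Finset.mem_filter.2 ⟨hmem _ hk₁, hk₁⟩⟩
    obtain ⟨hk₀T, hk₀u⟩ := Finset.mem_filter.1 hk₀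
    set t := h k₀ / (-u k₀) with ht
    have ht0 : 0 ≤ t := div_nonneg (hh _) (by linarith)
    have hnn : ∀ k, 0 ≤ (h + t • u) k := by
      intro k
      simp only [Pi.add_apply, Pi.smul_apply, smul_eq_mul]
      rcases lt_or_ge (u k) 0 with hk | hk
      · have h1 := hmin k (Finset.mem_filter.2 ⟨hmem _ hk, hk⟩)
        rw [le_div_iff₀ (by linarith)] at h1
        linarith
      · have := hh k
        positivity
    have h2 := hc k₀ hk₀T (h + t • u) hnn (by
      intro k hk
      simp only [Pi.add_apply, Pi.smul_apply, smul_eq_mul]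
      by_cases hkk : k = k₀
      · subst hkk
        rw [ht, div_neg, neg_mul, div_mul_cancel₀ _ hk₀u.ne, add_neg_cancel]
      · have hkT : k ∉ T := fun h' => hk (Finset.mem_erase.2 ⟨hkk, h'⟩)
        simp [hT k hkT, huT k hkT])
    have h3 : f (h + t • u) = f h := by simp [hfu]
    rw [h3] at h2
    calc h i ≤ (h + t • u) i := by
          simp only [Pi.add_apply, Pi.smul_apply, smul_eq_mul]
          nlinarith
      _ ≤ c k₀ * ‖f h‖ := h2
      _ ≤ _ := by
          gcongr
          exact Finset.single_le_sum hc0 hk₀T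

/-! ### Covered indices and the cover order -/

/-- The index `i` alone is a cover link of `G`: on the nonnegative orthant, `hᵀ G h ≤ τ ^ 2`
bounds `h i` by a fixed multiple of `τ`. -/
def IsCoveredIndex (G : Matrix (Fin N) (Fin N) ℝ) (i : Fin N) : Prop :=
  ∃ c : ℝ, ∀ τ : ℝ, 0 < τ → ∀ h : Fin N → ℝ, (∀ k, 0 ≤ h k) → h ⬝ᵥ (G *ᵥ h) ≤ τ ^ 2 → h i ≤ c * τ

open Classical in
/-- The set of all covered indices of `G`. -/
def coveredIndices (G : Matrix (Fin N) (Fin N) ℝ) : Finset (Fin N) :=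
  Finset.univ.filter (IsCoveredIndex G)

theorem mem_coveredIndices {G : Matrix (Fin N) (Fin N) ℝ} {i : Fin N} :
    i ∈ coveredIndices G ↔ IsCoveredIndex G i := by
  simp [coveredIndices]

theorem isCoverLink_iff {G : Matrix (Fin N) (Fin N) ℝ} {r : ℕ} {n : Fin r → Fin N} :
    IsCoverLink G n ↔ Function.Injective n ∧ ∀ k, n k ∈ coveredIndices G := by
  simp only [mem_coveredIndices]
  refine and_congr_right fun _ => ⟨?_, fun h => ?_⟩
  · rintro ⟨c, hc⟩ k
    exact ⟨c k, fun τ hτ h h0 hG => (hc τ hτ ⟨h0, hG⟩ k).2⟩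
  · choose c hc using h
    exact ⟨c, fun τ hτ h hh k => ⟨hh.1 _, hc k τ hτ h hh.1 hh.2⟩⟩

theorem coverOrder_eq_card (G : Matrix (Fin N) (Fin N) ℝ) :
    coverOrder G = (coveredIndices G).card := by
  apply le_antisymm
  · obtain ⟨n, hn⟩ := isCovered_coverOrder G
    obtain ⟨hinj, hmem⟩ := isCoverLink_iff.1 hn
    simpa using Finset.card_le_card_of_injOn (s := Finset.univ) n (fun k _ => hmem k) hinj.injOn
  · exact le_csSup ⟨N, fun _ h => IsCovered.le h⟩
      ⟨(coveredIndices G).orderEmbOfFin rfl, isCoverLink_iff.2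
        ⟨((coveredIndices G).orderEmbOfFin rfl).injective, Finset.orderEmbOfFin_mem _ _⟩⟩

theorem exists_pos_const_coveredIndices (G : Matrix (Fin N) (Fin N) ℝ) :
    ∃ c : ℝ, 0 < c ∧ ∀ τ : ℝ, 0 < τ → ∀ h : Fin N → ℝ, (∀ k, 0 ≤ h k) →
      h ⬝ᵥ (G *ᵥ h) ≤ τ ^ 2 → ∀ i ∈ coveredIndices G, h i ≤ c * τ := by
  choose! c hc using fun i (hi : i ∈ coveredIndices G) => mem_coveredIndices.1 hi
  refine ⟨1 + ∑ i, |c i|, by positivity, fun τ hτ h h0 hG i hi => (hc i hi τ hτ h h0 hG).trans ?_⟩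
  gcongr
  have := Finset.single_le_sum (f := fun i => |c i|) (fun i _ => abs_nonneg (c i))
    (Finset.mem_univ i)
  linarith [le_abs_self (c i)]

theorem dotProduct_errorGram (X X' : Matrix (Fin L) (Fin N) ℝ) (h : Fin N → ℝ) :
    h ⬝ᵥ (errorGram X X' *ᵥ h) = ((X - X') *ᵥ h) ⬝ᵥ ((X - X') *ᵥ h) := by
  rw [errorGram, ← Matrix.mulVec_mulVec, Matrix.dotProduct_mulVec, Matrix.vecMul_transpose]

theorem norm_sq_le_dotProduct_self {ι : Type*} [Fintype ι] (v : ι → ℝ) : ‖v‖ ^ 2 ≤ v ⬝ᵥ v := by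
  have h : ‖v‖ ≤ √(v ⬝ᵥ v) := by
    refine (pi_norm_le_iff_of_nonneg (Real.sqrt_nonneg _)).2 fun i => ?_
    refine Real.le_sqrt_of_sq_le ?_
    rw [Real.norm_eq_abs, sq_abs, sq]
    exact Finset.single_le_sum (f := fun i => v i * v i) (fun i _ => mul_self_nonneg _)
      (Finset.mem_univ i)
  calc ‖v‖ ^ 2 ≤ √(v ⬝ᵥ v) ^ 2 := by gcongr
    _ = _ := Real.sq_sqrt (Finset.sum_nonneg fun i _ => mul_self_nonneg _)

/-- A single nonnegative vector of the kernel of `X - X'` detects the covered indices: it is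
positive exactly at the indices that are not covered. -/
theorem exists_ker_pos_iff_notMem_coveredIndices (X X' : Matrix (Fin L) (Fin N) ℝ) :
    ∃ v : Fin N → ℝ, (∀ i, 0 ≤ v i) ∧ (X - X') *ᵥ v = 0 ∧
      ∀ i, v i = 0 ↔ i ∈ coveredIndices (errorGram X X') := by
  have h1 : ∀ i, ∃ v : Fin N → ℝ, (∀ i, 0 ≤ v i) ∧ (X - X') *ᵥ v = 0 ∧
      (i ∉ coveredIndices (errorGram X X') → v i ≠ 0) := by
    intro i
    by_contra! hcon
    have hf : ∀ v : Fin N → ℝ, (∀ k, 0 ≤ v k) → (X - X').mulVecLin v = 0 → v i = 0 :=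
      fun v hv h => (hcon v hv h).2
    obtain ⟨c, hc0, hc⟩ := exists_coord_le_of_ker _ i hf Finset.univ
    refine (hcon 0 (fun _ => le_rfl) (by simp)).1 (mem_coveredIndices.2 ⟨c, fun τ hτ h h0 hG => ?_⟩)
    refine (hc h h0 (by simp)).trans ?_
    gcongr
    rw [dotProduct_errorGram] at hG
    exact le_of_sq_le_sq ((norm_sq_le_dotProduct_self _).trans hG) hτ.le
  choose w hw0 hwA hwi using h1
  have hA : (X - X') *ᵥ (∑ k, w k) = 0 := by
    rw [Matrix.mulVec_sum]
    exact Finset.sum_eq_zero fun k _ => hwA k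
  have hnn : ∀ i, 0 ≤ (∑ k, w k) i := fun i => by
    rw [Finset.sum_apply]
    exact Finset.sum_nonneg fun k _ => hw0 k i
  refine ⟨∑ k, w k, hnn, hA, fun i => ⟨fun h => ?_, fun h => ?_⟩⟩
  · by_contra hi
    rw [Finset.sum_apply] at h
    exact hwi i hi ((Finset.sum_eq_zero_iff_of_nonneg fun k _ => hw0 k i).1 h i (Finset.mem_univ i))
  · -- all multiples of the kernel vector satisfy the constraint with `τ = 1`
    obtain ⟨c, hc⟩ := mem_coveredIndices.1 h
    by_contra hne
    have hpos := lt_of_le_of_ne (hnn i) (Ne.symm hne)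
    set v := ∑ k, w k
    have h2 := hc 1 one_pos (((|c| + 1) / v i) • v)
      (fun k => mul_nonneg (by positivity) (hnn k))
      (by rw [dotProduct_errorGram, Matrix.mulVec_smul, hA]; simp)
    rw [Pi.smul_apply, smul_eq_mul, div_mul_cancel₀ _ hne] at h2
    linarith [le_abs_self c]

/-! ### Gaussian tails -/

theorem gaussianReal_Iic_le {m x : ℝ} {v : NNReal} (hv : v ≠ 0) (hx : 0 ≤ x) :
    (gaussianReal m v).real (Set.Iic (m - x)) ≤ Real.exp (-(x ^ 2 / (2 * v))) := by
  have hv' : (0 : ℝ) < v := lt_of_le_of_ne v.2 (fun h => hv (NNReal.coe_eq_zero.1 h.symm))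
  -- Chernoff's bound at its optimal parameter
  have h := measure_le_le_exp_mul_mgf (μ := gaussianReal m v) (X := id) (t := -(x / v)) (m - x)
    (neg_nonpos.2 (by positivity)) (integrable_exp_mul_gaussianReal _)
  rw [mgf_id_gaussianReal, ← Real.exp_add] at h
  refine h.trans (Real.exp_le_exp.2 (le_of_eq ?_))
  field_simp
  ring

theorem mul_le_gaussianReal_Ioc {m a b κ : ℝ} {v : NNReal} (hv : v ≠ 0) (hκ : 0 ≤ κ)
    (h : ∀ x ∈ Set.Ioc a b, κ ≤ gaussianPDFReal m v x) :
    κ * (b - a) ≤ (gaussianReal m v).real (Set.Ioc a b) := by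
  rw [measureReal_def]
  refine (ENNReal.ofReal_le_iff_le_toReal (measure_ne_top _ _)).1 ?_
  rw [gaussianReal_apply _ hv, ENNReal.ofReal_mul hκ, ← Real.volume_Ioc, ← setLIntegral_const]
  exact setLIntegral_mono' measurableSet_Ioc fun x hx => ENNReal.ofReal_le_ofReal (h x hx)

/-- On a compact interval a nondegenerate Gaussian measure dominates a positive multiple of
Lebesgue measure. -/
theorem exists_pos_mul_le_gaussianReal_Ioc (m : ℝ) {v : NNReal} (hv : v ≠ 0) (A B : ℝ) :
    ∃ κ : ℝ, 0 < κ ∧ ∀ a b, A ≤ a → a ≤ b → b ≤ B →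
      κ * (b - a) ≤ (gaussianReal m v).real (Set.Ioc a b) := by
  rcases lt_or_ge B A with hAB | hAB
  · exact ⟨1, one_pos, fun a b h1 h2 h3 => by linarith⟩
  · have hcont : Continuous (gaussianPDFReal m v) := by
      unfold gaussianPDFReal
      fun_prop
    obtain ⟨x, -, hx⟩ := isCompact_Icc.exists_isMinOn (Set.nonempty_Icc.2 hAB) hcont.continuousOn
    refine ⟨gaussianPDFReal m v x, gaussianPDFReal_pos m v x hv, fun a b h1 h2 h3 => ?_⟩
    exact mul_le_gaussianReal_Ioc hv (gaussianPDFReal_nonneg _ _ _) fun y hy =>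
      hx ⟨h1.trans hy.1.le, hy.2.trans h3⟩

theorem gaussianReal_Iic_ge (m : ℝ) {v : NNReal} (hv : v ≠ 0) {x : ℝ} (hx : 0 ≤ x) :
    (√(2 * Real.pi * v))⁻¹ * Real.exp (-((x + 1) ^ 2 / (2 * v))) ≤
      (gaussianReal m v).real (Set.Iic (m - x)) := by
  have h := mul_le_gaussianReal_Ioc (m := m) (a := m - x - 1) (b := m - x)
    (κ := (√(2 * Real.pi * v))⁻¹ * Real.exp (-((x + 1) ^ 2 / (2 * v)))) hv (by positivity)
    (by
      rintro y ⟨hy1, hy2⟩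
      refine mul_le_mul_of_nonneg_left (Real.exp_le_exp.2 ?_) (by positivity)
      have hsq : (y - m) ^ 2 ≤ (x + 1) ^ 2 := by nlinarith
      calc -((x + 1) ^ 2 / (2 * (v : ℝ))) ≤ -((y - m) ^ 2 / (2 * (v : ℝ))) := by gcongr
        _ = _ := (neg_div _ _).symm)
  rw [show m - x - (m - x - 1) = 1 by ring, mul_one] at h
  exact h.trans (measureReal_mono fun y hy => hy.2)

theorem tendsto_log_gaussianReal_Iic (m : ℝ) {v : NNReal} (hv : v ≠ 0) :
    Tendsto (fun x : ℝ => Real.log ((gaussianReal m v).real (Set.Iic (m - x))) / x ^ 2) atTop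
      (𝓝 (-(1 / (2 * (v : ℝ))))) := by
  have hv' : (0 : ℝ) < v := lt_of_le_of_ne v.2 (fun h => hv (NNReal.coe_eq_zero.1 h.symm))
  set κ := (√(2 * Real.pi * v))⁻¹ with hκ
  have hκ0 : 0 < κ := by positivity
  have hinv : Tendsto (fun x : ℝ => x⁻¹) atTop (𝓝 0) := tendsto_inv_atTop_zero
  have hlow : Tendsto (fun x : ℝ => Real.log κ * x⁻¹ ^ 2 - (1 + x⁻¹) ^ 2 / (2 * v)) atTop
      (𝓝 (-(1 / (2 * (v : ℝ))))) := by
    have := ((hinv.pow 2).const_mul (Real.log κ)).sub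
      (((hinv.const_add 1).pow 2).div_const (2 * (v : ℝ)))
    simpa using this
  refine tendsto_of_tendsto_of_tendsto_of_le_of_le' hlow tendsto_const_nhds ?_ ?_
  · filter_upwards [eventually_gt_atTop 0] with x hx
    rw [le_div_iff₀ (by positivity)]
    have h := Real.log_le_log (by positivity) (gaussianReal_Iic_ge m hv hx.le)
    rw [← hκ, Real.log_mul hκ0.ne' (Real.exp_pos _).ne', Real.log_exp] at h
    refine le_trans (le_of_eq ?_) h
    field_simp
    ring
  · filter_upwards [eventually_gt_atTop 0] with x hx
    rw [div_le_iff₀ (by positivity)]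
    have hpos : 0 < (gaussianReal m v).real (Set.Iic (m - x)) :=
      lt_of_lt_of_le (by positivity) (gaussianReal_Iic_ge m hv hx.le)
    have h := Real.log_le_log hpos (gaussianReal_Iic_le hv hx.le)
    rw [Real.log_exp] at h
    exact h.trans (le_of_eq (by ring))

theorem gaussianQ_antitone : Antitone gaussianQ := fun _ _ h =>
  measureReal_mono (Set.Ioi_subset_Ioi h)

theorem gaussianQ_nonneg (x : ℝ) : 0 ≤ gaussianQ x := measureReal_nonneg

theorem gaussianQ_le_one (x : ℝ) : gaussianQ x ≤ 1 := measureReal_le_one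

theorem gaussianQ_pos (x : ℝ) : 0 < gaussianQ x := by
  obtain ⟨κ, hκ, h⟩ := exists_pos_mul_le_gaussianReal_Ioc 0 one_ne_zero x (x + 1)
  have := h x (x + 1) le_rfl (by linarith) le_rfl
  rw [add_sub_cancel_left, mul_one] at this
  exact hκ.trans_le (this.trans (measureReal_mono fun y hy => hy.1))

theorem gaussianQ_le {x : ℝ} (hx : 0 ≤ x) : gaussianQ x ≤ Real.exp (-(x ^ 2 / 2)) := by
  have h := measure_ge_le_exp_mul_mgf (μ := gaussianReal 0 1) (X := id) (t := x) x
    hx (integrable_exp_mul_gaussianReal _)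
  rw [mgf_id_gaussianReal, ← Real.exp_add] at h
  have h1 : gaussianQ x ≤ (gaussianReal 0 1).real {y | x ≤ id y} :=
    measureReal_mono fun y (hy : x < y) => hy.le
  refine h1.trans (h.trans (Real.exp_le_exp.2 ?_))
  simp only [NNReal.coe_one]
  nlinarith

/-! ### Log-normal distributions -/

theorem toNNReal_sq_ne_zero {s : ℝ} (hs : 0 < s) : Real.toNNReal (s ^ 2) ≠ 0 := by
  simpa using hs.ne'

instance isProbabilityMeasure_logNormal (m s : ℝ) : IsProbabilityMeasure (logNormal m s) :=
  Measure.isProbabilityMeasure_map Real.measurable_exp.aemeasurable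

theorem ae_pos_logNormal (m s : ℝ) : ∀ᵐ x ∂(logNormal m s), 0 < x := by
  rw [logNormal, ae_map_iff Real.measurable_exp.aemeasurable measurableSet_Ioi]
  exact Eventually.of_forall Real.exp_pos

theorem logNormal_Ioc_zero (m s : ℝ) {t : ℝ} (ht : 0 < t) :
    (logNormal m s).real (Set.Ioc 0 t) =
      (gaussianReal m (Real.toNNReal (s ^ 2))).real (Set.Iic (Real.log t)) := by
  rw [logNormal, map_measureReal_apply Real.measurable_exp measurableSet_Ioc]
  congr 1
  ext x
  simp [Real.exp_pos, Real.le_log_iff_exp_le ht]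

theorem logNormal_Ioc (m s : ℝ) {a b : ℝ} (ha : 0 < a) (hb : 0 < b) :
    (logNormal m s).real (Set.Ioc a b) =
      (gaussianReal m (Real.toNNReal (s ^ 2))).real (Set.Ioc (Real.log a) (Real.log b)) := by
  rw [logNormal, map_measureReal_apply Real.measurable_exp measurableSet_Ioc]
  congr 1
  ext x
  simp [Real.log_lt_iff_lt_exp ha, Real.le_log_iff_exp_le hb]

/-- Away from `0`, a log-normal distribution has density bounded below on bounded intervals. -/
theorem exists_pos_mul_le_logNormal_Ioc (m : ℝ) {s v : ℝ} (hs : 0 < s) (hv : 0 < v) :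
    ∃ κ : ℝ, 0 < κ ∧ ∀ τ, 0 < τ → τ ≤ 1 → κ * τ ≤ (logNormal m s).real (Set.Ioc v (v + τ)) := by
  obtain ⟨κ, hκ, h⟩ := exists_pos_mul_le_gaussianReal_Ioc m (toNNReal_sq_ne_zero hs)
    (Real.log v) (Real.log (v + 1))
  refine ⟨κ / (v + 1), by positivity, fun τ hτ hτ1 => ?_⟩
  rw [logNormal_Ioc m s hv (by positivity)]
  refine le_trans ?_ (h _ _ le_rfl (Real.log_le_log hv (by linarith))
    (Real.log_le_log (by positivity) (by linarith)))
  rw [div_mul_eq_mul_div, mul_div_assoc]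
  gcongr
  rw [← Real.log_div (by positivity) hv.ne']
  refine le_trans ?_ (Real.one_sub_inv_le_log_of_pos (by positivity))
  rw [inv_div, one_sub_div (by positivity), add_sub_cancel_left]
  gcongr

theorem logNormal_Ioc_zero_pos (m : ℝ) {s t : ℝ} (hs : 0 < s) (ht : 0 < t) :
    0 < (logNormal m s).real (Set.Ioc 0 t) := by
  rw [logNormal_Ioc_zero m s ht]
  obtain ⟨κ, hκ, h⟩ := exists_pos_mul_le_gaussianReal_Ioc m (toNNReal_sq_ne_zero hs)
    (Real.log t - 1) (Real.log t)
  have := h _ _ le_rfl (by linarith) le_rfl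
  rw [sub_sub_cancel, mul_one] at this
  exact hκ.trans_le (this.trans (measureReal_mono fun y hy => hy.2))

theorem logNormal_Ioc_pos (m : ℝ) {s v t : ℝ} (hs : 0 < s) (hv : 0 ≤ v) (ht : 0 < t) :
    0 < (logNormal m s).real (Set.Ioc v (v + t)) := by
  rcases hv.eq_or_lt with rfl | hv
  · rw [zero_add]
    exact logNormal_Ioc_zero_pos m hs ht
  · obtain ⟨κ, hκ, h⟩ := exists_pos_mul_le_logNormal_Ioc m hs hv
    have h1 : 0 < min t 1 := lt_min ht one_pos
    refine ((mul_pos hκ h1).trans_le (h _ h1 (min_le_right _ _))).trans_le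
      (measureReal_mono (Set.Ioc_subset_Ioc_right ?_))
    linarith [min_le_left t 1]

/-! ### Decay on the scale of `ln² ρ` -/

/-- The quantity `-8 ln f(ρ) / ln² ρ`, whose limit as `ρ → ∞` is the diversity gain attached
to the error probability `f`. -/
def logRate (f : ℝ → ℝ) (ρ : ℝ) : ℝ :=
  -(8 * Real.log (f ρ) / Real.log ρ ^ 2)

theorem logRate_le_logRate {f g : ℝ → ℝ} {ρ : ℝ} (hf : 0 < f ρ) (h : f ρ ≤ g ρ) :
    logRate g ρ ≤ logRate f ρ := by
  unfold logRate
  gcongr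

theorem tendsto_logRate_const (c : ℝ) : Tendsto (logRate fun _ => c) atTop (𝓝 0) := by
  have h : Tendsto (fun ρ => Real.log ρ ^ 2) atTop atTop :=
    (tendsto_pow_atTop two_ne_zero).comp Real.tendsto_log_atTop
  have h2 := (h.const_div_atTop (8 * Real.log c)).neg
  rwa [neg_zero] at h2

theorem tendsto_logRate_mul {f g : ℝ → ℝ} {a b : ℝ} (hf : Tendsto (logRate f) atTop (𝓝 a))
    (hg : Tendsto (logRate g) atTop (𝓝 b)) (hf0 : ∀ᶠ ρ in atTop, 0 < f ρ)
    (hg0 : ∀ᶠ ρ in atTop, 0 < g ρ) :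
    Tendsto (logRate fun ρ => f ρ * g ρ) atTop (𝓝 (a + b)) := by
  refine (hf.add hg).congr' ?_
  filter_upwards [hf0, hg0] with ρ h1 h2
  rw [logRate, logRate, logRate, Real.log_mul h1.ne' h2.ne']
  ring

theorem tendsto_logRate_prod {ι : Type*} (s : Finset ι) {f : ι → ℝ → ℝ} {a : ι → ℝ}
    (hf : ∀ i ∈ s, Tendsto (logRate (f i)) atTop (𝓝 (a i)))
    (hf0 : ∀ i ∈ s, ∀ᶠ ρ in atTop, 0 < f i ρ) :
    Tendsto (logRate fun ρ => ∏ i ∈ s, f i ρ) atTop (𝓝 (∑ i ∈ s, a i)) := by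
  refine (tendsto_finsetSum s hf).congr' ?_
  filter_upwards [(eventually_all_finset s).2 hf0] with ρ h
  simp only [logRate]
  rw [Real.log_prod fun i hi => (h i hi).ne', Finset.mul_sum, Finset.sum_div, Finset.sum_neg_distrib]

/-- A sum is at most twice its larger term, and the factor two is negligible on this scale. -/
theorem min_logRate_le_logRate_add {f g : ℝ → ℝ} {ρ : ℝ} (hf : 0 < f ρ) (hg : 0 < g ρ) :
    logRate (fun _ => 2) ρ + min (logRate f ρ) (logRate g ρ) ≤
      logRate (fun ρ => f ρ + g ρ) ρ := by
  have key : ∀ {f g : ℝ → ℝ}, 0 < f ρ → 0 < g ρ → f ρ ≤ g ρ →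
      logRate (fun _ => 2) ρ + min (logRate f ρ) (logRate g ρ) ≤
        logRate (fun ρ => f ρ + g ρ) ρ := by
    intro f g hf hg hfg
    have h1 : logRate (fun ρ => 2 * g ρ) ρ ≤ logRate (fun ρ => f ρ + g ρ) ρ :=
      logRate_le_logRate (by positivity) (by linarith)
    refine le_trans ?_ h1
    have h2 : logRate (fun ρ => 2 * g ρ) ρ = logRate (fun _ => 2) ρ + logRate g ρ := by
      rw [logRate, logRate, logRate, Real.log_mul two_ne_zero hg.ne']
      ring
    rw [h2]
    gcongr
    exact min_le_right _ _
  rcases le_total (f ρ) (g ρ) with h | h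
  · exact key hf hg h
  · simpa only [min_comm, add_comm (f _)] using key hg hf h

/-- If `t` decays like `ρ ^ (-1/2)` up to factors negligible on the logarithmic scale, then the
probability that a log-normal variable is at most `t` has rate `1 / s ^ 2`. -/
theorem tendsto_logRate_logNormal_Ioc_zero (m : ℝ) {s : ℝ} (hs : 0 < s) {t : ℝ → ℝ}
    (ht0 : ∀ᶠ ρ in atTop, 0 < t ρ)
    (ht : Tendsto (fun ρ => Real.log (t ρ) / Real.log ρ) atTop (𝓝 (-(1 / 2)))) :
    Tendsto (logRate fun ρ => (logNormal m s).real (Set.Ioc 0 (t ρ))) atTop (𝓝 (s ^ 2)⁻¹) := by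
  have hL := Real.tendsto_log_atTop
  have hx : Tendsto (fun ρ => (m - Real.log (t ρ)) / Real.log ρ) atTop (𝓝 (1 / 2)) := by
    have := (hL.const_div_atTop m).sub ht
    simpa [sub_div] using this
  have hxtop : Tendsto (fun ρ => m - Real.log (t ρ)) atTop atTop := by
    refine (hx.pos_mul_atTop (by norm_num) hL).congr' ?_
    filter_upwards [hL.eventually_gt_atTop 0] with ρ h
    exact div_mul_cancel₀ _ h.ne'
  have h := ((tendsto_log_gaussianReal_Iic m (toNNReal_sq_ne_zero hs)).comp hxtop).mul (hx.pow 2)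
  have h2 := (h.const_mul 8).neg
  rw [Real.coe_toNNReal _ (sq_nonneg s),
    show -(8 * (-(1 / (2 * s ^ 2)) * (1 / 2) ^ 2)) = (s ^ 2)⁻¹ by field_simp; norm_num] at h2
  refine h2.congr' ?_
  filter_upwards [hxtop.eventually_gt_atTop 0, ht0] with ρ h3 h4
  simp only [Function.comp_apply, logRate, sub_sub_cancel]
  rw [logNormal_Ioc_zero m s h4]
  field_simp

theorem tendsto_logRate_logNormal_Ioc_pos (m : ℝ) {s v : ℝ} (hs : 0 < s) (hv : 0 < v) {t : ℝ → ℝ}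
    (ht0 : ∀ᶠ ρ in atTop, 0 < t ρ) (ht1 : ∀ᶠ ρ in atTop, t ρ ≤ 1)
    (ht : Tendsto (fun ρ => Real.log (t ρ) / Real.log ρ) atTop (𝓝 (-(1 / 2)))) :
    Tendsto (logRate fun ρ => (logNormal m s).real (Set.Ioc v (v + t ρ))) atTop (𝓝 0) := by
  obtain ⟨κ, hκ, h⟩ := exists_pos_mul_le_logNormal_Ioc m hs hv
  have hrt : Tendsto (logRate t) atTop (𝓝 0) := by
    have := ((ht.mul (tendsto_inv_atTop_zero.comp Real.tendsto_log_atTop)).const_mul 8).neg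
    simp only [mul_zero, neg_zero] at this
    refine this.congr fun ρ => ?_
    simp only [Function.comp_apply, logRate]
    ring
  have hup := tendsto_logRate_mul (tendsto_logRate_const κ) hrt (Eventually.of_forall fun _ => hκ) ht0
  rw [add_zero] at hup
  refine tendsto_of_tendsto_of_tendsto_of_le_of_le' (tendsto_logRate_const 1) hup ?_ ?_
  · filter_upwards [ht0, ht1] with ρ h0 h1
    exact logRate_le_logRate ((by positivity : 0 < κ * t ρ).trans_le (h _ h0 h1)) measureReal_le_one
  · filter_upwards [ht0, ht1] with ρ h0 h1
    exact logRate_le_logRate (by positivity) (h _ h0 h1)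

/-! ### Bounds on the average pairwise error probability -/

theorem dotProduct_errorGram_nonneg (X X' : Matrix (Fin L) (Fin N) ℝ) (h : Fin N → ℝ) :
    0 ≤ h ⬝ᵥ (errorGram X X' *ᵥ h) := by
  rw [dotProduct_errorGram]
  exact Finset.sum_nonneg fun i _ => mul_self_nonneg _

section Fading

variable {Ω : Type*} [MeasurableSpace Ω] {P : Measure Ω}
  {H : Ω → Matrix (Fin N) (Fin M) ℝ} {μ σ : Fin N → Fin M → ℝ}

theorem IsLogNormalFading.measureReal_box (hH : IsLogNormalFading P H μ σ)
    (T : Finset (Fin N × Fin M)) {B : Fin N × Fin M → Set ℝ} (hB : ∀ p, MeasurableSet (B p)) :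
    P.real {ω | ∀ p ∈ T, H ω p.1 p.2 ∈ B p} =
      ∏ p ∈ T, (logNormal (μ p.1 p.2) (σ p.1 p.2)).real (B p) := by
  have h := hH.indep.measure_inter_preimage_eq_mul T (sets := B) fun p _ => hB p
  have hset : {ω | ∀ p ∈ T, H ω p.1 p.2 ∈ B p} =
      ⋂ p ∈ T, (fun ω => H ω p.1 p.2) ⁻¹' B p := by
    ext ω
    simp
  rw [hset, measureReal_def, h, ENNReal.toReal_prod]
  refine Finset.prod_congr rfl fun p _ => ?_
  rw [← Measure.map_apply_of_aemeasurable (hH.law p.1 p.2).aemeasurable (hB p),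
    (hH.law p.1 p.2).map_eq, measureReal_def]

theorem IsLogNormalFading.ae_pos (hH : IsLogNormalFading P H μ σ) :
    ∀ᵐ ω ∂P, ∀ i j, 0 < H ω i j := by
  refine ae_all_iff.2 fun i => ae_all_iff.2 fun j => ?_
  have h := ae_pos_logNormal (μ i j) (σ i j)
  rw [← (hH.law i j).map_eq] at h
  exact ae_of_ae_map (hH.law i j).aemeasurable h

variable [IsProbabilityMeasure P]

theorem IsLogNormalFading.integrable_condPairwiseError (hH : IsLogNormalFading P H μ σ) (ρ : ℝ)
    (X X' : Matrix (Fin L) (Fin N) ℝ) :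
    Integrable (fun ω => condPairwiseError ρ X X' (H ω)) P := by
  have hmeas : ∀ i j, AEMeasurable (fun ω => H ω i j) P := fun i j => (hH.law i j).aemeasurable
  have hd : AEMeasurable (fun ω => √(sqDist ρ X X' (H ω)) / 2) P := by
    simp only [sqDist, dotProduct, mulVec]
    fun_prop
  refine Integrable.of_bound
    (gaussianQ_antitone.measurable.comp_aemeasurable hd).aestronglyMeasurable 1 ?_
  refine Eventually.of_forall fun ω => ?_
  rw [Real.norm_eq_abs, condPairwiseError, abs_of_nonneg (gaussianQ_nonneg _)]
  exact gaussianQ_le_one _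

/-- Unless every channel gain `h i j` with `i` covered is at most `c * τ`, one of the columns is
outside the region `hᵀ ΔXᵀ ΔX h ≤ τ ^ 2`, so that the squared distance is at least
`ρ / N * τ ^ 2`. -/
theorem IsLogNormalFading.pairwiseError_le (hH : IsLogNormalFading P H μ σ)
    {X X' : Matrix (Fin L) (Fin N) ℝ} {c : ℝ}
    (hc : ∀ τ : ℝ, 0 < τ → ∀ h : Fin N → ℝ, (∀ k, 0 ≤ h k) →
      h ⬝ᵥ (errorGram X X' *ᵥ h) ≤ τ ^ 2 → ∀ i ∈ coveredIndices (errorGram X X'), h i ≤ c * τ)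
    {ρ τ : ℝ} (hρ : 0 ≤ ρ) (hτ : 0 < τ) :
    pairwiseError P H ρ X X' ≤ gaussianQ (√(ρ / N) * τ / 2) +
      ∏ p ∈ coveredIndices (errorGram X X') ×ˢ Finset.univ,
        (logNormal (μ p.1 p.2) (σ p.1 p.2)).real (Set.Ioc 0 (c * τ)) := by
  set T := coveredIndices (errorGram X X') ×ˢ (Finset.univ : Finset (Fin M)) with hT
  set B : Set Ω := {ω | ∀ p ∈ T, H ω p.1 p.2 ∈ Set.Ioc 0 (c * τ)} with hBdef
  have hB : NullMeasurableSet B P := by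
    have : B = ⋂ p ∈ T, (fun ω => H ω p.1 p.2) ⁻¹' Set.Ioc 0 (c * τ) := by
      ext ω
      simp [hBdef]
    rw [this]
    exact T.nullMeasurableSet_biInter fun p _ =>
      (hH.law p.1 p.2).aemeasurable.nullMeasurableSet_preimage measurableSet_Ioc
  rw [← hH.measureReal_box T (B := fun _ => Set.Ioc 0 (c * τ)) fun _ => measurableSet_Ioc]
  have hint : Integrable (B.indicator fun _ => (1 : ℝ)) P :=
    (integrable_const 1).indicator₀ hB
  have hle : pairwiseError P H ρ X X' ≤
      ∫ ω, (gaussianQ (√(ρ / N) * τ / 2) + B.indicator (fun _ => (1 : ℝ)) ω) ∂P := by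
    refine integral_mono_ae (hH.integrable_condPairwiseError ρ X X')
      ((integrable_const _).add hint) ?_
    filter_upwards [hH.ae_pos] with ω hω
    by_cases hωB : ω ∈ B
    · rw [Set.indicator_of_mem hωB]
      have := gaussianQ_le_one (√(sqDist ρ X X' (H ω)) / 2)
      have := gaussianQ_nonneg (√(ρ / N) * τ / 2)
      rw [condPairwiseError]
      linarith
    · rw [Set.indicator_of_notMem hωB, add_zero, condPairwiseError]
      refine gaussianQ_antitone ?_
      obtain ⟨j, hj⟩ : ∃ j, τ ^ 2 < (fun i => H ω i j) ⬝ᵥ (errorGram X X' *ᵥ fun i => H ω i j) := by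
        by_contra! hcon
        refine hωB fun p hp => ⟨hω _ _, ?_⟩
        exact hc τ hτ (fun i => H ω i p.2) (fun i => (hω i p.2).le) (hcon p.2) p.1
          (Finset.mem_product.1 hp).1
      gcongr
      refine Real.le_sqrt_of_sq_le ?_
      rw [mul_pow, Real.sq_sqrt (by positivity), sqDist]
      gcongr
      exact hj.le.trans (Finset.single_le_sum
        (f := fun j => (fun i => H ω i j) ⬝ᵥ (errorGram X X' *ᵥ fun i => H ω i j))
        (fun j _ => dotProduct_errorGram_nonneg X X' _) (Finset.mem_univ j))
  refine hle.trans (le_of_eq ?_)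
  rw [integral_add (integrable_const _) hint, integral_indicator₀ hB]
  simp [hBdef]

/-- If all columns of the channel matrix lie within `1 / √ρ` of a vector `v` with `ΔX v = 0`, the
squared distance is bounded independently of `ρ`. -/
theorem IsLogNormalFading.exists_le_pairwiseError (hH : IsLogNormalFading P H μ σ)
    {X X' : Matrix (Fin L) (Fin N) ℝ} {v : Fin N → ℝ} (hv : (X - X') *ᵥ v = 0) :
    ∃ q : ℝ, 0 < q ∧ ∀ ρ : ℝ, 0 < ρ →
      q * ∏ p : Fin N × Fin M,
        (logNormal (μ p.1 p.2) (σ p.1 p.2)).real (Set.Ioc (v p.1) (v p.1 + (√ρ)⁻¹)) ≤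
      pairwiseError P H ρ X X' := by
  set K : ℝ := ∑ l, (∑ i, |(X - X') l i|) ^ 2 with hK
  refine ⟨gaussianQ (√(1 / N * (M * K)) / 2), gaussianQ_pos _, fun ρ hρ => ?_⟩
  rw [← hH.measureReal_box Finset.univ (B := fun p => Set.Ioc (v p.1) (v p.1 + (√ρ)⁻¹))
    fun _ => measurableSet_Ioc]
  refine le_trans ?_ (mul_meas_ge_le_integral_of_nonneg
    (Eventually.of_forall fun ω => gaussianQ_nonneg _) (hH.integrable_condPairwiseError ρ X X')
    (gaussianQ (√(1 / N * (M * K)) / 2)))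
  refine mul_le_mul_of_nonneg_left (measureReal_mono fun ω hω => ?_) (gaussianQ_nonneg _)
  refine gaussianQ_antitone ?_
  have hquad : ∀ j, (fun i => H ω i j) ⬝ᵥ (errorGram X X' *ᵥ fun i => H ω i j) ≤ K * ρ⁻¹ := by
    intro j
    have hsub : (X - X') *ᵥ (fun i => H ω i j) = (X - X') *ᵥ ((fun i => H ω i j) - v) := by
      rw [Matrix.mulVec_sub, hv, sub_zero]
    rw [dotProduct_errorGram, hsub, dotProduct, hK, Finset.sum_mul]
    refine Finset.sum_le_sum fun l _ => ?_
    have habs : |((X - X') *ᵥ ((fun i => H ω i j) - v)) l| ≤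
        (∑ i, |(X - X') l i|) * (√ρ)⁻¹ := by
      rw [mulVec, dotProduct, Finset.sum_mul]
      refine (Finset.abs_sum_le_sum_abs _ _).trans (Finset.sum_le_sum fun i _ => ?_)
      rw [abs_mul]
      gcongr
      have hij : H ω i j ∈ Set.Ioc (v i) (v i + (√ρ)⁻¹) := hω (i, j) (Finset.mem_univ _)
      rw [Pi.sub_apply, abs_of_pos (sub_pos.2 hij.1)]
      linarith [hij.2]
    rw [← sq, ← sq_abs]
    calc _ ≤ ((∑ i, |(X - X') l i|) * (√ρ)⁻¹) ^ 2 := by gcongr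
      _ = _ := by rw [mul_pow, inv_pow, Real.sq_sqrt hρ.le]
  rw [sqDist]
  gcongr √?_ / 2
  calc ρ / N * ∑ j, (fun i => H ω i j) ⬝ᵥ (errorGram X X' *ᵥ fun i => H ω i j)
      ≤ ρ / N * ∑ _j : Fin M, K * ρ⁻¹ := by
        gcongr with j
        exact hquad j
    _ = 1 / N * (M * K) := by
        simp only [Finset.sum_const, Finset.card_univ, Fintype.card_fin, nsmul_eq_mul]
        field_simp

/-! ### The diversity gain -/

/-- The diversity gain is the sum of `σ i j ^ (-2)` over the covered indices `i` and all `j`. -/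
theorem IsLogNormalFading.hasLargeScaleDiversityGain (hH : IsLogNormalFading P H μ σ)
    (hσ : ∀ i j, 0 < σ i j) (hN : 0 < N) (X X' : Matrix (Fin L) (Fin N) ℝ) :
    HasLargeScaleDiversityGain P H X X'
      (∑ p ∈ coveredIndices (errorGram X X') ×ˢ Finset.univ, (σ p.1 p.2 ^ 2)⁻¹) := by
  set S := coveredIndices (errorGram X X') with hS
  set D := ∑ p ∈ S ×ˢ (Finset.univ : Finset (Fin M)), (σ p.1 p.2 ^ 2)⁻¹ with hD
  have hD0 : 0 ≤ D := Finset.sum_nonneg fun p _ => by positivity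
  have hN' : (0 : ℝ) < N := Nat.cast_pos.2 hN
  have hL := Real.tendsto_log_atTop
  obtain ⟨v, hv0, hvker, hvS⟩ := exists_ker_pos_iff_notMem_coveredIndices X X'
  obtain ⟨q, hq, hlow⟩ := hH.exists_le_pairwiseError hvker
  obtain ⟨c, hc0, hc⟩ := exists_pos_const_coveredIndices (errorGram X X')
  have hlogsqrt : ∀ᶠ ρ : ℝ in atTop, Real.log (√ρ)⁻¹ / Real.log ρ = -(1 / 2) := by
    filter_upwards [eventually_ge_atTop 0, hL.eventually_gt_atTop 0] with ρ h0 h1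
    rw [Real.log_inv, Real.log_sqrt h0]
    field_simp
  set box : Fin N × Fin M → ℝ → ℝ := fun p ρ =>
    (logNormal (μ p.1 p.2) (σ p.1 p.2)).real (Set.Ioc (v p.1) (v p.1 + (√ρ)⁻¹)) with hbox
  have hsqrt0 : ∀ᶠ ρ : ℝ in atTop, 0 < (√ρ)⁻¹ := by
    filter_upwards [eventually_gt_atTop 0] with ρ h0
    positivity
  have hsqrt1 : ∀ᶠ ρ : ℝ in atTop, (√ρ)⁻¹ ≤ 1 := by
    filter_upwards [eventually_ge_atTop 1] with ρ h0
    exact inv_le_one_of_one_le₀ (Real.one_le_sqrt.2 h0)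
  have hsqrtlog : Tendsto (fun ρ : ℝ => Real.log (√ρ)⁻¹ / Real.log ρ) atTop (𝓝 (-(1 / 2))) :=
    tendsto_const_nhds.congr' (hlogsqrt.mono fun ρ h => h.symm)
  have hbox0 : ∀ p, ∀ᶠ ρ in atTop, 0 < box p ρ := fun p =>
    hsqrt0.mono fun ρ h => logNormal_Ioc_pos _ (hσ _ _) (hv0 _) h
  have hboxrate : ∀ p, Tendsto (logRate (box p)) atTop
      (𝓝 (if p ∈ S ×ˢ (Finset.univ : Finset (Fin M)) then (σ p.1 p.2 ^ 2)⁻¹ else 0)) := by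
    intro p
    have hpS : p ∈ S ×ˢ (Finset.univ : Finset (Fin M)) ↔ v p.1 = 0 := by
      rw [hvS, Finset.mem_product, hS]
      simp
    by_cases hp : v p.1 = 0
    · rw [if_pos (hpS.2 hp)]
      simp only [hbox, hp, zero_add]
      exact tendsto_logRate_logNormal_Ioc_zero _ (hσ _ _) hsqrt0 hsqrtlog
    · rw [if_neg (hpS.not.2 hp)]
      exact tendsto_logRate_logNormal_Ioc_pos _ (hσ _ _)
        (lt_of_le_of_ne (hv0 _) (Ne.symm hp)) hsqrt0 hsqrt1 hsqrtlog
  have hsmall0 : ∀ᶠ ρ in atTop, 0 < q * ∏ p, box p ρ := by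
    filter_upwards [eventually_all.2 hbox0] with ρ h
    exact mul_pos hq (Finset.prod_pos fun p _ => h p)
  have hsmall : Tendsto (logRate fun ρ => q * ∏ p, box p ρ) atTop (𝓝 D) := by
    have h := tendsto_logRate_mul (tendsto_logRate_const q)
      (tendsto_logRate_prod Finset.univ (fun p _ => hboxrate p) (fun p _ => hbox0 p))
      (Eventually.of_forall fun _ => hq)
      ((eventually_all.2 hbox0).mono fun ρ h => Finset.prod_pos fun p _ => h p)
    rwa [zero_add, Finset.sum_ite_mem, Finset.univ_inter] at h
  -- with this `τ`, the Gaussian tail in the upper bound has rate `D + 1`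
  set τ : ℝ → ℝ := fun ρ => √(N * (D + 1)) * Real.log ρ * (√ρ)⁻¹ with hτ
  have hτ0 : ∀ᶠ ρ in atTop, 0 < τ ρ := by
    filter_upwards [eventually_gt_atTop 0, hL.eventually_gt_atTop 0] with ρ h0 h1
    have : 0 < √(N * (D + 1)) := Real.sqrt_pos.2 (by positivity)
    positivity
  have hcτ0 : ∀ᶠ ρ in atTop, 0 < c * τ ρ := hτ0.mono fun ρ h => mul_pos hc0 h
  have hτlog : Tendsto (fun ρ => Real.log (c * τ ρ) / Real.log ρ) atTop (𝓝 (-(1 / 2))) := by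
    have hll : Tendsto (fun ρ => Real.log (Real.log ρ) / Real.log ρ) atTop (𝓝 0) :=
      Real.isLittleO_log_id_atTop.tendsto_div_nhds_zero.comp hL
    have h := ((hL.const_div_atTop (Real.log (c * √(N * (D + 1))))).add hll).add_const (-(1 / 2))
    rw [add_zero, zero_add] at h
    refine h.congr' ?_
    filter_upwards [eventually_gt_atTop 0, hL.eventually_gt_atTop 0, hlogsqrt] with ρ h0 h1 h2
    have h3 : 0 < √(N * (D + 1)) := Real.sqrt_pos.2 (by positivity)
    have h4 : 0 < √ρ := Real.sqrt_pos.2 h0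
    rw [← h2, ← add_div, ← add_div, ← Real.log_mul (by positivity) h1.ne',
      ← Real.log_mul (by positivity) (by positivity)]
    congr 2
    rw [hτ]
    ring
  have hup : Tendsto (logRate fun ρ => ∏ p ∈ S ×ˢ (Finset.univ : Finset (Fin M)),
      (logNormal (μ p.1 p.2) (σ p.1 p.2)).real (Set.Ioc 0 (c * τ ρ))) atTop (𝓝 D) :=
    tendsto_logRate_prod _
      (fun p _ => tendsto_logRate_logNormal_Ioc_zero _ (hσ _ _) hcτ0 hτlog)
      (fun p _ => hcτ0.mono fun ρ h => logNormal_Ioc_zero_pos _ (hσ _ _) h)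
  have hexp : Tendsto (logRate fun ρ => Real.exp (-((D + 1) * Real.log ρ ^ 2 / 8))) atTop
      (𝓝 (D + 1)) := by
    refine tendsto_const_nhds.congr' ?_
    filter_upwards [hL.eventually_gt_atTop 0] with ρ h
    rw [logRate, Real.log_exp]
    field_simp
  have hmin := (tendsto_logRate_const 2).add (hexp.min hup)
  rw [zero_add, min_eq_right (by linarith)] at hmin
  refine tendsto_of_tendsto_of_tendsto_of_le_of_le' hmin hsmall ?_ ?_
  · filter_upwards [eventually_gt_atTop 0, hL.eventually_gt_atTop 0, hτ0, hcτ0, hsmall0] with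
      ρ h0 h1 h2 h3 h4
    refine (min_logRate_le_logRate_add
      (f := fun ρ => Real.exp (-((D + 1) * Real.log ρ ^ 2 / 8)))
      (g := fun ρ => ∏ p ∈ S ×ˢ (Finset.univ : Finset (Fin M)),
        (logNormal (μ p.1 p.2) (σ p.1 p.2)).real (Set.Ioc 0 (c * τ ρ))) (Real.exp_pos _)
      (Finset.prod_pos fun p _ => logNormal_Ioc_zero_pos _ (hσ _ _) h3)).trans ?_
    refine logRate_le_logRate (f := fun ρ => pairwiseError P H ρ X X') (h4.trans_le (hlow ρ h0)) ?_
    refine (hH.pairwiseError_le hc h0.le h2).trans (add_le_add_left ?_ _)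
    refine (gaussianQ_le (by positivity)).trans (Real.exp_le_exp.2 (neg_le_neg (le_of_eq ?_)))
    have h5 : √ρ ^ 2 = ρ := Real.sq_sqrt h0.le
    simp only [hτ]
    rw [div_pow, mul_pow, mul_pow, mul_pow, inv_pow, h5, Real.sq_sqrt (by positivity),
      Real.sq_sqrt (by positivity)]
    field_simp
    norm_num
  · filter_upwards [eventually_gt_atTop 0, hsmall0] with ρ h0 h4
    exact logRate_le_logRate (g := fun ρ => pairwiseError P H ρ X X') h4 (hlow ρ h0)

end Fading

/-! ### Comparison of weighted sums -/

theorem sum_eq_sum_iff_card_eq_of_subset {ι : Type*} {s t : Finset ι} {w : ι → ℝ}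
    (hw : ∀ i, 0 < w i) (hst : s ⊆ t) : ∑ i ∈ t, w i = ∑ i ∈ s, w i ↔ t.card = s.card := by
  classical
  refine ⟨fun h => ?_, fun h => by rw [Finset.eq_of_subset_of_card_le hst h.le]⟩
  congr 1
  by_contra hne
  obtain ⟨i, hit, his⟩ := Finset.exists_of_ssubset (hst.ssubset_of_ne (Ne.symm hne))
  exact (Finset.sum_lt_sum_of_subset hst hit his (hw i) fun j _ _ => (hw j).le).ne' h

end OpticalMIMO

end

theorem mainTheorem2 {N M L : ℕ} (hM : 0 < M)
    {Ω : Type*} [MeasurableSpace Ω] (P : Measure Ω) [IsProbabilityMeasure P]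
    (μ σ : Fin N → Fin M → ℝ) (hσ : ∀ i j, 0 < σ i j)
    (H : Ω → Matrix (Fin N) (Fin M) ℝ) (hH : OpticalMIMO.IsLogNormalFading P H μ σ)
    (C : Set (Matrix (Fin L) (Fin N) ℝ)) (hC : ∀ X ∈ C, ∀ l i, 0 ≤ X l i) :
    (∀ X ∈ C, ∀ X' ∈ C, X ≠ X' →
      ∃ D : ℝ, OpticalMIMO.HasLargeScaleDiversityGain P H X X' D ∧
        (∀ (r : ℕ) (n : Fin r → Fin N),
          OpticalMIMO.IsCoverLink (OpticalMIMO.errorGram X X') n →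
            (D = ∑ j, ∑ k, (σ (n k) j ^ 2)⁻¹ ↔
              OpticalMIMO.coverOrder (OpticalMIMO.errorGram X X') = r)) ∧
        (∀ i : Equiv.Perm (Fin N),
          OpticalMIMO.IsCoverLink (OpticalMIMO.errorGram X X')
              (fun k => i (Fin.castLE
                (OpticalMIMO.coverOrder_le (OpticalMIMO.errorGram X X')) k)) →
            ∀ (r : ℕ) (hr : r ≤ N),
              (D = ∑ j, ∑ k : Fin r, (σ (i (Fin.castLE hr k)) j ^ 2)⁻¹ ↔
                OpticalMIMO.coverOrder (OpticalMIMO.errorGram X X') = r)) ∧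
        (D = ∑ j, ∑ i, (σ i j ^ 2)⁻¹ ↔
          OpticalMIMO.HasFullCover (OpticalMIMO.errorGram X X'))) ∧
    (OpticalMIMO.AchievesFullLargeScaleDiversity P H σ C ↔
      ∀ X ∈ C, ∀ X' ∈ C, X ≠ X' →
        OpticalMIMO.HasFullCover (OpticalMIMO.errorGram X X')) := by
  classical
  -- `w i` is the contribution of the index `i` to the diversity gain
  set w : Fin N → ℝ := fun i => ∑ j, (σ i j ^ 2)⁻¹ with hw
  have hw0 : ∀ i, 0 < w i := fun i =>
    Finset.sum_pos (fun j _ => by have := hσ i j; positivity) ⟨⟨0, hM⟩, Finset.mem_univ _⟩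
  have hgain : ∀ X X' : Matrix (Fin L) (Fin N) ℝ, X ≠ X' →
      OpticalMIMO.HasLargeScaleDiversityGain P H X X'
        (∑ i ∈ OpticalMIMO.coveredIndices (OpticalMIMO.errorGram X X'), w i) := by
    intro X X' hne
    have hN : 0 < N := by
      rcases Nat.eq_zero_or_pos N with rfl | h
      · exact absurd (Matrix.ext fun _ i => i.elim0) hne
      · exact h
    have h := hH.hasLargeScaleDiversityGain hσ hN X X'
    rwa [Finset.sum_product] at h
  have hlink : ∀ {r : ℕ} (n : Fin r → Fin N), Function.Injective n →
      ∑ j, ∑ k, (σ (n k) j ^ 2)⁻¹ = ∑ i ∈ Finset.univ.image n, w i ∧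
        (Finset.univ.image n).card = r := by
    intro r n hn
    rw [Finset.sum_image fun a _ b _ h => hn h, Finset.card_image_of_injective _ hn, Finset.sum_comm]
    simp [hw]
  have hfull : ∀ X X' : Matrix (Fin L) (Fin N) ℝ,
      (∑ i ∈ OpticalMIMO.coveredIndices (OpticalMIMO.errorGram X X'), w i =
        ∑ j, ∑ i, (σ i j ^ 2)⁻¹ ↔ OpticalMIMO.HasFullCover (OpticalMIMO.errorGram X X')) := by
    intro X X'
    rw [OpticalMIMO.HasFullCover, OpticalMIMO.coverOrder_eq_card,
      show ∑ j, ∑ i, (σ i j ^ 2)⁻¹ = ∑ i, w i from Finset.sum_comm, eq_comm,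
      OpticalMIMO.sum_eq_sum_iff_card_eq_of_subset hw0 (Finset.subset_univ _), Finset.card_univ,
      Fintype.card_fin, eq_comm]
  refine ⟨fun X _ X' _ hne => ⟨_, hgain X X' hne, fun r n hn => ?_, fun i hi r hr => ?_,
    hfull X X'⟩, ?_⟩
  · obtain ⟨hinj, hmem⟩ := OpticalMIMO.isCoverLink_iff.1 hn
    obtain ⟨h1, h2⟩ := hlink n hinj
    rw [h1, OpticalMIMO.coverOrder_eq_card, OpticalMIMO.sum_eq_sum_iff_card_eq_of_subset hw0, h2]
    exact Finset.image_subset_iff.2 fun k _ => hmem k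
  · obtain ⟨hinj, hmem⟩ := OpticalMIMO.isCoverLink_iff.1 hi
    -- the first `R_c` indices exhaust the covered ones, so both sums run over initial segments
    have hS : Finset.univ.image (fun k => i (Fin.castLE
        (OpticalMIMO.coverOrder_le (OpticalMIMO.errorGram X X')) k)) =
        OpticalMIMO.coveredIndices (OpticalMIMO.errorGram X X') := by
      refine Finset.eq_of_subset_of_card_le (Finset.image_subset_iff.2 fun k _ => hmem k) ?_
      rw [(hlink _ hinj).2, OpticalMIMO.coverOrder_eq_card]
    obtain ⟨h1, h2⟩ := hlink (fun k : Fin r => i (Fin.castLE hr k))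
      (i.injective.comp (Fin.castLE_injective hr))
    have hmono : ∀ {a b : ℕ} (ha : a ≤ N) (hb : b ≤ N), a ≤ b →
        Finset.univ.image (fun k : Fin a => i (Fin.castLE ha k)) ⊆
          Finset.univ.image (fun k : Fin b => i (Fin.castLE hb k)) := by
      intro a b ha hb hab
      refine Finset.image_subset_iff.2 fun k _ => Finset.mem_image.2
        ⟨Fin.castLE hab k, Finset.mem_univ _, rfl⟩
    rw [h1, OpticalMIMO.coverOrder_eq_card]
    rcases le_total r (OpticalMIMO.coverOrder (OpticalMIMO.errorGram X X')) with hle | hle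
    · rw [OpticalMIMO.sum_eq_sum_iff_card_eq_of_subset hw0 (hS ▸ hmono _ _ hle), h2]
    · rw [eq_comm, OpticalMIMO.sum_eq_sum_iff_card_eq_of_subset hw0 (hS ▸ hmono _ _ hle), h2,
        eq_comm]
  · refine forall₂_congr fun X _ => forall₂_congr fun X' _ => forall_congr' fun hne => ?_
    rw [← hfull X X']
    exact ⟨fun h => tendsto_nhds_unique (hgain X X' hne) h, fun h => h ▸ hgain X X' hne⟩
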